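/- Say that a first-order theory $T$ has the independence property if there are a formula $\varphi(\bar x,\bar y)$ (with $\bar x,\bar y$ finite tuples of variables) and a model $M$ of $T$ containing tuples $(\bar a_i)_{i\in\omega}$ and $(\bar b_I)_{I\subseteq\omega}$ such that $M\models\varphi(\bar a_i,\bar b_I)$ if and only if $i\in I$; otherwise $T$ is NIP. A field is called NIP if its complete theory in the language of rings is NIP. For a field $K$ of characteristic $p>0$, an extension field $L$ of $K$ is an Artin–Schreier extension of $K$ if $L=K(\alpha)$ for some $\alpha\in L\setminus K$ with $\alpha^p-\alpha\in K$. Theorem. Let $p$ be a prime and let $K$ be an infinite NIP field of characteristic $p$. Then $K$ is Artin–Schreier closed: for every $y\in K$ there is $x\in K$ with $x^p-x=y$, and $K$ has no Artin–Schreier extension. -/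

import Mathlib

universe u v

/-- A theory `T` has the independence property if some formula `φ(x̄, ȳ)` (with `x̄`, `ȳ` finite
tuples of variables) and some model `M` of `T` contain tuples `a i` (for `i : ℕ`) and `b I`
(for `I ⊆ ℕ`) such that `M ⊨ φ(a i, b I)` if and only if `i ∈ I`.  By the downward
Löwenheim-Skolem theorem, the models in the universe of the language are enough: at most continuum
many elements are involved. -/
def FirstOrder.Language.Theory.HasIndependenceProperty {L : FirstOrder.Language.{u, v}}
    (T : L.Theory) : Prop :=
  ∃ (m n : ℕ) (φ : L.Formula (Fin m ⊕ Fin n)) (M : T.ModelType.{u, v, max u v})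
    (a : ℕ → Fin m → M) (b : Set ℕ → Fin n → M),
    ∀ (i : ℕ) (I : Set ℕ), φ.Realize (Sum.elim (a i) (b I)) ↔ i ∈ I

/-- A theory is NIP (dependent) if it does not have the independence property. -/
def FirstOrder.Language.Theory.IsNIP {L : FirstOrder.Language.{u, v}} (T : L.Theory) : Prop :=
  ¬ T.HasIndependenceProperty

/-- A field `K` is NIP if its complete first-order theory in the language of rings is NIP. -/
def IsNIPField (K : Type u) [Field K] : Prop :=
  letI := FirstOrder.Ring.compatibleRingOfRing K
  (FirstOrder.Language.ring.completeTheory K).IsNIP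

/-- For fields of characteristic `p > 0`: the extension `L/K` is an Artin-Schreier extension if
`L = K(α)` for some `α ∈ L \ K` with `α ^ p - α ∈ K`. -/
def IsArtinSchreierExtension (p : ℕ) (K : Type u) (L : Type v) [Field K] [Field L] [Algebra K L] :
    Prop :=
  ∃ α : L, α ∉ (algebraMap K L).range ∧ α ^ p - α ∈ (algebraMap K L).range ∧
    IntermediateField.adjoin K {α} = ⊤

/-! Put ℘(x) = x^p - x and H_b = {t | b t ∈ ℘(K)}. These additive subgroups are uniformly definable,
so NIP bounds the size of irredundant families of them (Baldwin–Saxl): in a large enough family some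
H_{b i₀} contains the intersection of the others. Take c independent over F_p and b ≠ 0 orthogonal
to the Frobenius twists c^(p^j), j ≥ 1. Given y, Moore matrices yield t and x_i with ℘(x_i) = b_i t
for i ≠ i₀, and a prescribed value of one linear form in the x_i. Redundancy supplies x_{i₀}, and ∑
c_i x_i divided by c_{i₀} is then a root of ℘(x) = y. -/

section Moore

/-! ### Moore matrices and additive polynomials. -/

variable {K : Type u} [Field K] (p : ℕ)

/-- The Moore matrix of a tuple: its rows are the iterated Frobenius images of the tuple. -/
def mooreMatrix {m : ℕ} (c : Fin m → K) : Matrix (Fin m) (Fin m) K :=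
  Matrix.of fun j i => c i ^ p ^ (j : ℕ)

theorem mooreMatrix_apply {m : ℕ} (c : Fin m → K) (j i : Fin m) :
    mooreMatrix p c j i = c i ^ p ^ (j : ℕ) := rfl

theorem exists_linearIndependent_fin_of_infinite [Fact p.Prime] [Algebra (ZMod p) K] [Infinite K]
    (n : ℕ) : ∃ c : Fin n → K, LinearIndependent (ZMod p) c := by
  have h : ¬ Module.rank (ZMod p) K < Cardinal.aleph0 := by
    intro h
    have := Module.rank_lt_aleph0_iff.mp h
    have := Module.finite_of_finite (ZMod p) (M := K)
    exact not_finite K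
  obtain ⟨s, hs, hli⟩ := le_rank_iff_exists_linearIndependent_finset.mp
    ((Cardinal.natCast_le_aleph0 (n := n)).trans (not_lt.mp h))
  exact ⟨fun i => (s.equivFinOfCardEq hs).symm i, hli.comp _ (Equiv.injective _)⟩

variable [Fact p.Prime] [CharP K p]

theorem exists_algebraMap_eq_of_pow_eq_self [Algebra (ZMod p) K] {x : K} (hx : x ^ p = x) :
    ∃ z : ZMod p, algebraMap (ZMod p) K z = x := by
  have h := (Subfield.mem_bot_iff_pow_eq_self K p).mpr hx
  rw [← ZMod.fieldRange_castHom_eq_bot p] at h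
  obtain ⟨z, hz⟩ := h
  exact ⟨z, by rw [← hz, Subsingleton.elim (algebraMap (ZMod p) K)]⟩

/-- A row relation is an additive polynomial of degree below p^m that vanishes on the F_p-span of
`c`, which has p^m elements. -/
theorem mooreMatrix_det_ne_zero [Algebra (ZMod p) K] {m : ℕ} {c : Fin m → K}
    (hc : LinearIndependent (ZMod p) c) : (mooreMatrix p c).det ≠ 0 := by
  classical
  intro h
  obtain ⟨w, hw0, hw⟩ := Matrix.exists_vecMul_eq_zero_iff.mpr h
  have hp : p.Prime := Fact.out
  set P : Polynomial K := ∑ j : Fin m, Polynomial.C (w j) * Polynomial.X ^ p ^ (j : ℕ) with hP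
  have hcoeff : ∀ j : Fin m, P.coeff (p ^ (j : ℕ)) = w j := by
    intro j
    rw [hP, Polynomial.finsetSum_coeff, Finset.sum_eq_single j]
    · simp
    · intro b _ hb
      rw [Polynomial.coeff_C_mul_X_pow, if_neg]
      intro hh
      exact hb (Fin.ext (Nat.pow_right_injective hp.two_le hh).symm)
    · simp
  have hm : 0 < m := by
    rcases Nat.eq_zero_or_pos m with rfl | h
    · exact absurd (Subsingleton.elim _ _) hw0
    · exact h
  have hdeg : P.natDegree < p ^ m := by
    refine lt_of_le_of_lt (Polynomial.natDegree_sum_le_of_forall_le (n := p ^ (m - 1)) _ _ ?_)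
      (Nat.pow_lt_pow_right hp.one_lt (by omega))
    intro j _
    exact (Polynomial.natDegree_C_mul_X_pow_le _ _).trans
      (Nat.pow_le_pow_right hp.pos (by omega))
  have hinj : Function.Injective fun l : Fin m → ZMod p => ∑ i, l i • c i :=
    linearIndependent_iff_injective_fintypeLinearCombination.mp hc
  have hroot : ∀ l : Fin m → ZMod p, P.eval (∑ i, l i • c i) = 0 := by
    intro l
    have key : ∀ j : Fin m, (∑ i, l i • c i) ^ p ^ (j : ℕ) = ∑ i, l i • c i ^ p ^ (j : ℕ) := by
      intro j
      rw [sum_pow_char_pow]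
      refine Finset.sum_congr rfl fun i _ => ?_
      rw [smul_pow, ZMod.pow_card_pow]
    simp only [hP, Polynomial.eval_finsetSum, Polynomial.eval_mul, Polynomial.eval_C,
      Polynomial.eval_pow, Polynomial.eval_X, key, Finset.mul_sum]
    rw [Finset.sum_comm]
    refine Finset.sum_eq_zero fun i _ => ?_
    have := congrFun hw i
    simp only [Matrix.vecMul, dotProduct, mooreMatrix_apply, Pi.zero_apply] at this
    simp only [mul_smul_comm, ← Finset.smul_sum, this, smul_zero]
  have hP0 : P = 0 := Polynomial.eq_zero_of_natDegree_lt_card_of_eval_eq_zero P hinj hroot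
    (by simpa [ZMod.card] using hdeg)
  exact hw0 (funext fun j => by rw [← hcoeff j, hP0]; simp)

/-- The rows j ≥ 1 of the Moore matrix of `d` have a one-dimensional kernel, spanned by `b`. Solving
for `x` with right-hand side y^(p^j) puts the vector x^p - x in that kernel. -/
theorem exists_artinSchreier_of_sum_eq [Algebra (ZMod p) K] {m : ℕ} {d b : Fin m → K}
    (hd : LinearIndependent (ZMod p) d) (hb0 : b ≠ 0)
    (hb : ∀ j, 1 ≤ j → j < m → ∑ i, d i ^ p ^ j * b i = 0) (y : K) :
    ∃ (t : K) (x : Fin m → K), (∀ i, x i ^ p - x i = b i * t) ∧ ∑ i, d i * x i = y := by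
  classical
  have hp : p.Prime := Fact.out
  have hu : IsUnit (mooreMatrix p d) :=
    (Matrix.isUnit_iff_isUnit_det _).mpr (mooreMatrix_det_ne_zero p hd).isUnit
  have hinj := Matrix.mulVec_injective_iff_isUnit.mpr hu
  obtain ⟨x, hx⟩ := Matrix.mulVec_surjective_iff_isUnit.mpr hu fun j => y ^ p ^ (j : ℕ)
  replace hx : ∀ j < m, ∑ i, d i ^ p ^ j * x i = y ^ p ^ j := fun j hj => congrFun hx ⟨j, hj⟩
  have hm : 0 < m := by
    rcases Nat.eq_zero_or_pos m with rfl | h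
    · exact absurd (Subsingleton.elim _ _) hb0
    · exact h
  have hker : ∀ j, 1 ≤ j → j < m → ∑ i, d i ^ p ^ j * (x i ^ p - x i) = 0 := by
    intro j hj hjm
    obtain ⟨j, rfl⟩ := Nat.exists_eq_add_of_le' hj
    have h1 := congrArg (· ^ p) (hx j (by omega))
    simp only [sum_pow_char, mul_pow, ← pow_mul, ← pow_succ] at h1
    simp only [mul_sub, Finset.sum_sub_distrib, h1, hx _ hjm, sub_self]
  set τ := ∑ i, d i * b i with hτ
  set σ := ∑ i, d i * (x i ^ p - x i) with hσ
  have hτ0 : τ ≠ 0 := by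
    intro h0
    refine hb0 (hinj ?_)
    rw [Matrix.mulVec_zero]
    ext ⟨j, hj⟩
    rcases Nat.eq_zero_or_pos j with rfl | hj'
    · simpa [Matrix.mulVec, dotProduct, mooreMatrix_apply] using h0
    · simpa [Matrix.mulVec, dotProduct, mooreMatrix_apply] using hb j hj' hj
  -- Row 0 fixes the scalar between two vectors of the kernel line.
  refine ⟨σ / τ, x, ?_, by simpa using hx 0 hm⟩
  refine congrFun (hinj (a₁ := fun i => x i ^ p - x i) (a₂ := fun i => b i * (σ / τ)) ?_)
  ext ⟨j, hj⟩
  simp only [Matrix.mulVec, dotProduct, mooreMatrix_apply, ← mul_assoc, ← Finset.sum_mul]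
  rcases Nat.eq_zero_or_pos j with rfl | hj'
  · simp only [pow_zero, pow_one, ← hτ, ← hσ]
    field_simp
  · rw [hker j hj' hj, hb j hj' hj, zero_mul]

/-- The additive map z ↦ z^p - c_{i₀}^(p-1) z has kernel F_p c_{i₀}, so it keeps the remaining c_i
independent. -/
theorem linearIndependent_artinSchreier_twist [Algebra (ZMod p) K] {m : ℕ} {c : Fin (m + 1) → K}
    (hc : LinearIndependent (ZMod p) c) (i₀ : Fin (m + 1)) :
    LinearIndependent (ZMod p) fun i => c (i₀.succAbove i) ^ p -
      c i₀ ^ (p - 1) * c (i₀.succAbove i) := by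
  have hp : p.Prime := Fact.out
  have hc0 : c i₀ ≠ 0 := hc.ne_zero i₀
  rw [Fintype.linearIndependent_iff] at hc ⊢
  intro l hl
  set e := ∑ i, l i • c (i₀.succAbove i) with he
  have hep : e ^ p = c i₀ ^ (p - 1) * e := by
    rw [he, sum_pow_char, Finset.mul_sum, ← sub_eq_zero, ← Finset.sum_sub_distrib, ← hl]
    refine Finset.sum_congr rfl fun i _ => ?_
    rw [smul_pow, ZMod.pow_card, smul_sub, mul_smul_comm]
  have hq : (e / c i₀) ^ p = e / c i₀ := by
    rw [div_pow, hep, div_eq_div_iff (pow_ne_zero _ hc0) hc0, mul_right_comm, ← pow_succ,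
      Nat.sub_add_cancel hp.one_le, mul_comm]
  obtain ⟨z, hz⟩ := exists_algebraMap_eq_of_pow_eq_self p hq
  have hz' : e = z • c i₀ := by rw [Algebra.smul_def, hz, div_mul_cancel₀ _ hc0]
  have := hc (i₀.insertNth (-z) l) (by
    rw [Fin.sum_univ_succAbove _ i₀]
    simp [← he, hz'])
  intro i
  simpa using this (i₀.succAbove i)

theorem artinSchreier_surjective_of_redundant [Algebra (ZMod p) K] {m : ℕ} {c b : Fin (m + 2) → K}
    (hc : LinearIndependent (ZMod p) c) (hb0 : b ≠ 0)
    (hb : ∀ j, 1 ≤ j → j < m + 2 → ∑ i, c i ^ p ^ j * b i = 0) (i₀ : Fin (m + 2))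
    (h : ∀ t, (∀ i, i ≠ i₀ → ∃ x, x ^ p - x = b i * t) → ∃ x, x ^ p - x = b i₀ * t) (y : K) :
    ∃ x : K, x ^ p - x = y := by
  have hp : p.Prime := Fact.out
  have hc0 : c i₀ ≠ 0 := hc.ne_zero i₀
  have hb1 : ∑ i, c i ^ p * b i = 0 := by simpa using hb 1 le_rfl (by omega)
  have hb0' : (fun i => b (i₀.succAbove i)) ≠ 0 := by
    intro h0
    have h0' : ∀ i, b (i₀.succAbove i) = 0 := congrFun h0
    rw [Fin.sum_univ_succAbove _ i₀] at hb1
    simp only [h0', mul_zero, Finset.sum_const_zero, add_zero, mul_eq_zero,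
      pow_ne_zero p hc0, false_or] at hb1
    exact hb0 (funext fun i => by
      rcases Fin.eq_self_or_eq_succAbove i₀ i with rfl | ⟨k, rfl⟩
      · exact hb1
      · exact h0' k)
  obtain ⟨t, x, hx, hxy⟩ := exists_artinSchreier_of_sum_eq p
    (linearIndependent_artinSchreier_twist p hc i₀) hb0' (by
      intro j hj hjm
      -- The p^j-th power of the twist involves only the twists j and j + 1 of `c`, both orthogonal
      -- to `b`; the i₀ term is zero.
      have hs : ∑ i, (c i ^ p - c i₀ ^ (p - 1) * c i) ^ p ^ j * b i = 0 := by
        have : ∀ i, (c i ^ p - c i₀ ^ (p - 1) * c i) ^ p ^ j * b i =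
            c i ^ p ^ (j + 1) * b i - (c i₀ ^ (p - 1)) ^ p ^ j * (c i ^ p ^ j * b i) := by
          intro i
          rw [sub_pow_char_pow, ← pow_mul, ← pow_succ', mul_pow]
          ring
        simp only [this, Finset.sum_sub_distrib, ← Finset.mul_sum, hb j hj (by omega),
          hb (j + 1) (by omega) (by omega), mul_zero, sub_self]
      rw [Fin.sum_univ_succAbove _ i₀, ← pow_succ, Nat.sub_add_cancel hp.one_le, sub_self,
        zero_pow (pow_ne_zero _ hp.ne_zero), zero_mul, zero_add] at hs
      exact hs) (c i₀ ^ p * y)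
  obtain ⟨x₀, hx₀⟩ := h t (fun i hi => by
    obtain ⟨k, rfl⟩ := Fin.exists_succAbove_eq hi
    exact ⟨_, hx k⟩)
  -- The difference of the sides is t ∑ c_i^p b_i = 0.
  have hs : ∑ i, c i ^ p * (i₀.insertNth x₀ x : Fin (m + 2) → K) i ^ p =
      ∑ i, c i ^ p * (i₀.insertNth x₀ x : Fin (m + 2) → K) i := by
    rw [← sub_eq_zero, ← Finset.sum_sub_distrib, ← zero_mul t, ← hb1, Finset.sum_mul]
    refine Finset.sum_congr rfl fun i _ => ?_
    rw [← mul_sub, mul_assoc]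
    congr 1
    rcases Fin.eq_self_or_eq_succAbove i₀ i with rfl | ⟨k, rfl⟩
    · simpa using hx₀
    · simpa using hx k
  set s := ∑ i, c i * (i₀.insertNth x₀ x : Fin (m + 2) → K) i with hsdef
  have hsp : s ^ p - c i₀ ^ (p - 1) * s = c i₀ ^ p * y := by
    rw [hsdef, sum_pow_char]
    simp only [mul_pow, hs, Finset.mul_sum]
    rw [← Finset.sum_sub_distrib, Fin.sum_univ_succAbove _ i₀, ← hxy]
    simp only [Fin.insertNth_apply_same, Fin.insertNth_apply_succAbove]
    rw [← mul_assoc, ← pow_succ, Nat.sub_add_cancel hp.one_le, sub_self, zero_add]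
    exact Finset.sum_congr rfl fun i _ => by ring
  refine ⟨s / c i₀, ?_⟩
  have hcp : c i₀ ^ p = c i₀ ^ (p - 1) * c i₀ := by rw [← pow_succ, Nat.sub_add_cancel hp.one_le]
  have : s / c i₀ = c i₀ ^ (p - 1) * s / c i₀ ^ p := by
    rw [hcp, mul_div_mul_left _ _ (pow_ne_zero _ hc0)]
  rw [div_pow, this, ← sub_div, hsp, mul_div_cancel_left₀ _ (pow_ne_zero _ hc0)]

theorem exists_frobenius_dual_vector [Algebra (ZMod p) K] {m : ℕ} {c : Fin (m + 1) → K}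
    (hc : LinearIndependent (ZMod p) c) :
    ∃ b : Fin (m + 1) → K, b ≠ 0 ∧ ∀ j, 1 ≤ j → j < m + 1 → ∑ i, c i ^ p ^ j * b i = 0 := by
  classical
  have hu : IsUnit (mooreMatrix p c) :=
    (Matrix.isUnit_iff_isUnit_det _).mpr (mooreMatrix_det_ne_zero p hc).isUnit
  obtain ⟨b, hb⟩ := Matrix.mulVec_surjective_iff_isUnit.mpr hu (Pi.single 0 1)
  refine ⟨b, ?_, fun j hj hjm => ?_⟩
  · rintro rfl
    simpa using congrFun hb 0
  · have := congrFun hb ⟨j, hjm⟩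
    rwa [Pi.single_eq_of_ne (by simp [Fin.ext_iff]; omega)] at this

end Moore

/-! ### Irredundant families of subgroups. -/

/-- If no subgroup of a finite family contains the intersection of the others, then subset sums
realize every membership pattern. -/
theorem AddSubgroup.exists_mem_iff_of_irredundant {A ι : Type*} [AddCommGroup A] [Fintype ι]
    (H : ι → AddSubgroup A) (h : ∀ i, ∃ t, (∀ j, j ≠ i → t ∈ H j) ∧ t ∉ H i) (I : Set ι) :
    ∃ t, ∀ i, t ∈ H i ↔ i ∉ I := by
  classical
  choose t ht ht' using h
  refine ⟨∑ j with j ∈ I, t j, fun i => ⟨fun hi hiI => ?_, fun hi => ?_⟩⟩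
  · rw [← Finset.add_sum_erase _ _ (a := i) (by simpa using hiI)] at hi
    refine ht' i ((AddSubgroup.add_mem_cancel_right _ (sum_mem fun j hj => ?_)).mp hi)
    exact ht j i (Finset.ne_of_mem_erase hj).symm
  · refine sum_mem fun j hj => ht j i ?_
    rintro rfl
    exact hi (Finset.mem_filter.mp hj).2

/-- The subgroup of those `t` for which `b * t` lies in the image of `x ↦ x ^ p - x`. -/
def artinSchreierSubgroup {K : Type u} [Field K] (p : ℕ) [Fact p.Prime] [CharP K p] (b : K) :
    AddSubgroup K where
  carrier := {t | ∃ x, x ^ p - x = b * t}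
  zero_mem' := ⟨0, by simp [(Fact.out : p.Prime).ne_zero]⟩
  add_mem' := by
    rintro s t ⟨x, hx⟩ ⟨y, hy⟩
    exact ⟨x + y, by rw [add_pow_char, mul_add, ← hx, ← hy]; ring⟩
  neg_mem' := by
    rintro t ⟨x, hx⟩
    refine ⟨-x, ?_⟩
    have h := sub_pow_char (p := p) 0 x
    rw [zero_sub, zero_pow (Fact.out : p.Prime).ne_zero, zero_sub] at h
    rw [h, mul_neg, ← hx]; ring

theorem mem_artinSchreierSubgroup {K : Type u} [Field K] {p : ℕ} [Fact p.Prime] [CharP K p]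
    {b t : K} : t ∈ artinSchreierSubgroup p b ↔ ∃ x, x ^ p - x = b * t := Iff.rfl

/-! ### Compactness and the defining formula. -/

section ModelTheory

universe w

open FirstOrder FirstOrder.Language

/-- By compactness, a formula that shatters sets of every finite size in a structure witnesses the
independence property of its complete theory. -/
theorem FirstOrder.Language.hasIndependenceProperty_completeTheory_of_finite_shattering
    {L : FirstOrder.Language.{u, v}} {M : Type w} [L.Structure M] [Nonempty M] {m n : ℕ}
    (φ : L.Formula (Fin m ⊕ Fin n))
    (h : ∀ N : ℕ, ∃ (a : ℕ → Fin m → M) (b : Set ℕ → Fin n → M), ∀ i < N, ∀ I : Set ℕ,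
      φ.Realize (Sum.elim (a i) (b I)) ↔ i ∈ I) :
    (L.completeTheory M).HasIndependenceProperty := by
  classical
  let α : Type := (ℕ × Fin m) ⊕ (Set ℕ × Fin n)
  let ψ (i : ℕ) (I : Set ℕ) : L.Formula α :=
    φ.relabel (Sum.map (fun k => (i, k)) fun k => (I, k))
  let θ (q : ℕ × Set ℕ) : L.Formula α := if q.1 ∈ q.2 then ψ q.1 q.2 else (ψ q.1 q.2).not
  let T (N : ℕ) : L[[α]].Theory := (L.lhomWithConstants α).onTheory (L.completeTheory M) ∪
    (fun q => Formula.equivSentence (θ q)) '' {q | q.1 < N}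
  have hT : Theory.IsSatisfiable (⋃ N, T N) := by
    rw [Theory.isSatisfiable_directed_union_iff]
    · intro N
      obtain ⟨a, b, hab⟩ := h N
      let w : α → M := Sum.elim (fun q => a q.1 q.2) fun q => b q.1 q.2
      let _ : (constantsOn α).Structure M := constantsOn.structure w
      -- `T N` only constrains indices below `N`, so `M` itself models it.
      have hM : M ⊨ T N := by
        refine (Theory.model_union_iff).mpr ⟨(LHom.onTheory_model _ _).2 inferInstance, ⟨?_⟩⟩
        rintro _ ⟨⟨i, I⟩, hi, rfl⟩
        rw [Formula.realize_equivSentence]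
        change (θ (i, I)).Realize w
        have key : (ψ i I).Realize w ↔ i ∈ I := by
          rw [← hab i hi I, Formula.realize_relabel]
          refine iff_of_eq (congrArg _ ?_)
          ext (k | k) <;> rfl
        by_cases hiI : i ∈ I
        · simp only [θ, hiI, if_true, key]
        · simpa only [θ, hiI, if_false, Formula.realize_not, key] using hiI
      exact Theory.Model.isSatisfiable M
    · refine Monotone.directed_le fun N N' hN => Set.union_subset_union_right _ ?_
      exact Set.image_mono fun q hq => lt_of_lt_of_le hq hN
  obtain ⟨N⟩ := hT
  have hN := N.is_model
  have hN1 : N ⊨ (L.lhomWithConstants α).onTheory (L.completeTheory M) :=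
    hN.mono (Set.subset_union_left.trans (Set.subset_iUnion T 0))
  let N' : ((L.lhomWithConstants α).onTheory (L.completeTheory M)).ModelType := hN1.bundled
  let _ : L.Structure N := (L.lhomWithConstants α).reduct N
  refine ⟨m, n, φ, N'.reduct (L.lhomWithConstants α), fun i k => (L.con (Sum.inl (i, k) : α) : N),
    fun I k => (L.con (Sum.inr (I, k) : α) : N), fun i I => ?_⟩
  have hθ : (Formula.equivSentence (θ (i, I))).Realize N :=
    hN.realize_of_mem _ (Set.mem_iUnion.mpr ⟨i + 1, Or.inr ⟨(i, I), Nat.lt_succ_self i, rfl⟩⟩)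
  rw [Formula.realize_equivSentence] at hθ
  have key : (ψ i I).Realize (fun a : α => (L.con a : N)) ↔ φ.Realize (Sum.elim
      (fun k => (L.con (Sum.inl (i, k) : α) : N)) fun k => (L.con (Sum.inr (I, k) : α) : N)) := by
    rw [Formula.realize_relabel]
    refine iff_of_eq (congrArg _ ?_)
    ext (k | k) <;> rfl
  refine Iff.trans key.symm ?_
  by_cases hiI : i ∈ I
  · simpa only [θ, hiI, if_true, iff_true] using hθ
  · simpa only [θ, hiI, if_false, Formula.realize_not, iff_false] using hθ

theorem FirstOrder.Ring.exists_formula_not_artinSchreier (p : ℕ) :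
    ∃ φ : Language.ring.Formula (Fin 1 ⊕ Fin 1), ∀ (K : Type u) [Field K]
      [FirstOrder.Ring.CompatibleRing K] (a b : Fin 1 → K),
      φ.Realize (Sum.elim a b) ↔ ¬ ∃ x : K, x ^ p - x = a 0 * b 0 := by
  let x : FreeCommRing ((Fin 1 ⊕ Fin 1) ⊕ Fin 1) := FreeCommRing.of (Sum.inr 0)
  let s : FreeCommRing ((Fin 1 ⊕ Fin 1) ⊕ Fin 1) := FreeCommRing.of (Sum.inl (Sum.inl 0))
  let t : FreeCommRing ((Fin 1 ⊕ Fin 1) ⊕ Fin 1) := FreeCommRing.of (Sum.inl (Sum.inr 0))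
  let ψ : Language.ring.BoundedFormula (Fin 1 ⊕ Fin 1) 1 :=
    (FirstOrder.Ring.termOfFreeCommRing (x ^ p - x)).bdEqual
      (FirstOrder.Ring.termOfFreeCommRing (s * t))
  refine ⟨ψ.ex.not, fun K _ _ a b => ?_⟩
  rw [Formula.realize_not, Formula.Realize, BoundedFormula.realize_ex]
  simp [ψ, x, s, t, Fin.snoc]

end ModelTheory

/-! ### NIP applied to the Artin–Schreier subgroups. -/

theorem IsNIPField.exists_redundant_artinSchreierSubgroup {p : ℕ} [Fact p.Prime] {K : Type u}
    [Field K] [CharP K p] (hK : IsNIPField K) :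
    ∃ N : ℕ, ∀ n ≥ N, ∀ b : Fin n → K, ∃ i, ∀ t, (∀ j, j ≠ i → t ∈ artinSchreierSubgroup p (b j)) →
      t ∈ artinSchreierSubgroup p (b i) := by
  by_contra! hcon
  let _ := FirstOrder.Ring.compatibleRingOfRing K
  obtain ⟨φ, hφ⟩ := FirstOrder.Ring.exists_formula_not_artinSchreier.{u} p
  refine hK (FirstOrder.Language.hasIndependenceProperty_completeTheory_of_finite_shattering φ
    fun N => ?_)
  obtain ⟨n, hn, b, hb⟩ := hcon N
  choose t ht using fun I : Set ℕ => AddSubgroup.exists_mem_iff_of_irredundant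
    (fun i => artinSchreierSubgroup p (b i)) hb {i | (i : ℕ) ∈ I}
  -- The default 0 is harmless: only indices below N ≤ n are tested.
  refine ⟨fun i _ => if h : i < n then b ⟨i, h⟩ else 0, fun I _ => t I, fun i hi I => ?_⟩
  have hin : i < n := lt_of_lt_of_le hi hn
  have := ht I ⟨i, hin⟩
  rw [mem_artinSchreierSubgroup] at this
  simp only [hφ, dif_pos hin, this]
  simp

theorem IsNIPField.exists_pow_sub_eq {p : ℕ} [Fact p.Prime] {K : Type u} [Field K] [CharP K p]
    [Infinite K] (hK : IsNIPField K) (y : K) : ∃ x : K, x ^ p - x = y := by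
  let _ : Algebra (ZMod p) K := ZMod.algebra K p
  obtain ⟨N, hN⟩ := hK.exists_redundant_artinSchreierSubgroup (p := p)
  obtain ⟨c, hc⟩ := exists_linearIndependent_fin_of_infinite (K := K) p (N + 2)
  obtain ⟨b, hb0, hb⟩ := exists_frobenius_dual_vector p hc
  obtain ⟨i₀, hi₀⟩ := hN (N + 2) (by omega) b
  exact artinSchreier_surjective_of_redundant p hc hb0 hb i₀ hi₀ y

/-- Two roots of x^p - x = y differ by an element of F_p, so a root in `K` forces α into `K`. -/
theorem not_isArtinSchreierExtension_of_surjective {p : ℕ} [Fact p.Prime] {K : Type u} [Field K]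
    [CharP K p] (h : ∀ y : K, ∃ x : K, x ^ p - x = y) (L : Type v) [Field L] [Algebra K L] :
    ¬ IsArtinSchreierExtension p K L := by
  rintro ⟨α, hα, ⟨y, hy⟩, -⟩
  obtain ⟨x, rfl⟩ := h y
  have : CharP L p := charP_of_injective_algebraMap (algebraMap K L).injective p
  let _ : Algebra (ZMod p) L := ZMod.algebra L p
  have hfix : (α - algebraMap K L x) ^ p = α - algebraMap K L x := by
    rw [sub_pow_char, sub_eq_sub_iff_sub_eq_sub, ← hy, map_sub, map_pow]
  obtain ⟨z, hz⟩ := exists_algebraMap_eq_of_pow_eq_self p hfix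
  refine hα ⟨ZMod.castHom dvd_rfl K z + x, ?_⟩
  rw [map_add, ← RingHom.comp_apply, Subsingleton.elim ((algebraMap K L).comp _)
    (algebraMap (ZMod p) L), hz, sub_add_cancel]

theorem theorem4p3 (p : ℕ) [Fact p.Prime] (K : Type u) [Field K] [CharP K p] [Infinite K]
    (hK : IsNIPField K) :
    (∀ y : K, ∃ x : K, x ^ p - x = y) ∧
      ∀ (L : Type v) [Field L] [Algebra K L], ¬ IsArtinSchreierExtension p K L :=
  ⟨hK.exists_pow_sub_eq, fun L => not_isArtinSchreierExtension_of_surjective hK.exists_pow_sub_eq L⟩
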